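/- Let $0=k_0<k_1<k_2<\cdots$ be a strictly increasing sequence of natural numbers and, for every $n\ge 0$, let $D_n$ be a subgroup of the alternating group $\mathrm{Alt}(\{k_n,\dots,k_{n+1}-1\})$. Let $\prod_{n\ge 0} D_n$ act on $\mathbb Z$ by letting $D_n$ act on $\{k_n,\dots,k_{n+1}-1\}$ for every $n$ and fixing every negative integer. Let $\mathrm{Alt}_f(\mathbb Z)$ be the group of finitely supported even permutations of $\mathbb Z$, and let $G$ be the group of permutations of $\mathbb Z$ generated by $\mathrm{Alt}_f(\mathbb Z)$ and $\prod_{n\ge 0} D_n$. Endow $G$ with the unique locally compact group topology for which the inclusion $\prod_{n\ge 0} D_n\hookrightarrow G$, where $\prod_{n\ge 0}D_n$ carries the product of the discrete topologies, is a homeomorphism onto its image and this image is open. Let $\mathrm{Sub}(G)$ be the space of closed subgroups of $G$ with the Chabauty topology, on which $G$ acts by conjugation. A URS of $G$ is a minimal non-empty closed $G$-invariant subset of $\mathrm{Sub}(G)$. A closed subgroup $H\le G$ has finite covolume if $G/H$ carries a $G$-invariant Borel probability measure. Then, for every choice of $(k_n)$ and $(D_n)$: (i) $G$ has no non-trivial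 URS's, that is, the URS's of $G$ are exactly $\{\{1\}\}$ and $\{G\}$; (ii) $G$ has no proper closed subgroup of finite covolume. -/

import Mathlib

open Topology

/-! ### The Chabauty space, URS's and finite covolume -/

section Chabauty

variable {G : Type*} [Group G] [TopologicalSpace G]

/-- The Chabauty topology on the set of closed subgroups of `G`, generated by the sets
`{H | H ∩ V ≠ ∅}` with `V` open and relatively compact and `{H | H ∩ C = ∅}` with `C` compact. -/
instance ClosedSubgroup.chabautyTopology : TopologicalSpace (ClosedSubgroup G) :=
  TopologicalSpace.generateFrom
    ({S | ∃ V : Set G, IsOpen V ∧ IsCompact (closure V) ∧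
        S = {H : ClosedSubgroup G | ((H : Set G) ∩ V).Nonempty}} ∪
     {S | ∃ C : Set G, IsCompact C ∧ S = {H : ClosedSubgroup G | (H : Set G) ∩ C = ∅}})

/-- The conjugate `g H g⁻¹` of a closed subgroup. -/
def ClosedSubgroup.conj [IsTopologicalGroup G] (g : G) (H : ClosedSubgroup G) :
    ClosedSubgroup G where
  toSubgroup := (H : Subgroup G).map (MulAut.conj g).toMonoidHom
  isClosed' := by
    have h : (((H : Subgroup G).map (MulAut.conj g).toMonoidHom : Subgroup G) : Set G) =
        (fun x => g⁻¹ * x * g) ⁻¹' (H : Set G) := by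
      ext x
      constructor
      · rintro ⟨y, hy, rfl⟩
        have h : g⁻¹ * (g * y * g⁻¹) * g = y := by group
        change g⁻¹ * (g * y * g⁻¹) * g ∈ H
        rw [h]
        exact hy
      · intro hx
        exact ⟨g⁻¹ * x * g, hx, by simp [mul_assoc]⟩
    change IsClosed (((H : Subgroup G).map (MulAut.conj g).toMonoidHom : Subgroup G) : Set G)
    rw [h]
    exact IsClosed.preimage (by fun_prop) H.isClosed'

/-- A uniformly recurrent subgroup of `G`: a minimal element among the nonempty closed
conjugation-invariant subsets of the Chabauty space of `G`. -/
def IsURS [IsTopologicalGroup G] (X : Set (ClosedSubgroup G)) : Prop :=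
  Minimal (fun Y : Set (ClosedSubgroup G) =>
    Y.Nonempty ∧ IsClosed Y ∧ ∀ g : G, ∀ H ∈ Y, H.conj g ∈ Y) X

variable (G) in
/-- The URS's of `G` are exactly the two singletons `{1}` and `{G}`. -/
def HasNoNontrivialURS [IsTopologicalGroup G] : Prop :=
  ∀ X : Set (ClosedSubgroup G), IsURS X ↔
    X = {H : ClosedSubgroup G | (H : Subgroup G) = ⊥} ∨
    X = {H : ClosedSubgroup G | (H : Subgroup G) = ⊤}

/-- `H` has finite covolume in `G`: the coset space `G ⧸ H` with its Borel `σ`-algebra carries a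
`G`-invariant probability measure. -/
def HasFiniteCovolume (H : ClosedSubgroup G) : Prop :=
  ∃ (_ : MeasurableSpace (G ⧸ (H : Subgroup G))) (_ : BorelSpace (G ⧸ (H : Subgroup G)))
    (μ : MeasureTheory.Measure (G ⧸ (H : Subgroup G))),
    MeasureTheory.IsProbabilityMeasure μ ∧
      MeasureTheory.SMulInvariantMeasure G (G ⧸ (H : Subgroup G)) μ

end Chabauty

/-! ### The finitary alternating group -/

/-- An even permutation of a finite set `s`, extended to `t ⊇ s`, is even. -/
theorem exists_even_extend {Ω : Type*} [DecidableEq Ω] {s t : Finset Ω} (hst : s ⊆ t)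
    (σ : Equiv.Perm s) (hσ : σ ∈ alternatingGroup s) :
    ∃ τ ∈ alternatingGroup t, Equiv.Perm.ofSubtype τ = Equiv.Perm.ofSubtype σ := by
  let f : s ↪ t := ⟨fun x => ⟨x, hst x.2⟩, fun x y h => Subtype.ext (by simpa using h)⟩
  refine ⟨σ.viaFintypeEmbedding f, ?_, ?_⟩
  · rw [Equiv.Perm.mem_alternatingGroup] at hσ ⊢
    rw [Equiv.Perm.viaFintypeEmbedding_sign, hσ]
  · ext x
    by_cases hx : x ∈ s
    · rw [Equiv.Perm.ofSubtype_apply_of_mem _ (hst hx), Equiv.Perm.ofSubtype_apply_of_mem _ hx]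
      have := σ.viaFintypeEmbedding_apply_image f ⟨x, hx⟩
      exact congrArg Subtype.val this
    · rw [Equiv.Perm.ofSubtype_apply_of_not_mem _ hx]
      by_cases hxt : x ∈ t
      · rw [Equiv.Perm.ofSubtype_apply_of_mem _ hxt,
          Equiv.Perm.viaFintypeEmbedding_apply_notMem_range]
        rintro ⟨y, hy⟩
        have hyx : (y : Ω) = x := congrArg Subtype.val hy
        exact hx (hyx ▸ y.2)
      · rw [Equiv.Perm.ofSubtype_apply_of_not_mem _ hxt]

/-- The finitary alternating group of `Ω`: the permutations given by an even permutation of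
some finite subset and fixing all other points. -/
def finitaryAlternatingGroup (Ω : Type*) [DecidableEq Ω] : Subgroup (Equiv.Perm Ω) where
  carrier := {g | ∃ s : Finset Ω, ∃ σ ∈ alternatingGroup s, Equiv.Perm.ofSubtype σ = g}
  one_mem' := ⟨∅, 1, one_mem _, map_one _⟩
  mul_mem' := by
    rintro _ _ ⟨s, σ, hσ, rfl⟩ ⟨t, τ, hτ, rfl⟩
    obtain ⟨σ', hσ', h1⟩ := exists_even_extend (Finset.subset_union_left (s₂ := t)) σ hσ
    obtain ⟨τ', hτ', h2⟩ := exists_even_extend (Finset.subset_union_right (s₁ := s)) τ hτ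
    exact ⟨s ∪ t, σ' * τ', mul_mem hσ' hτ', by rw [map_mul, h1, h2]⟩
  inv_mem' := by
    rintro _ ⟨s, σ, hσ, rfl⟩
    exact ⟨s, σ⁻¹, inv_mem hσ, map_inv _ _⟩

/-! ### The group attached to a sequence of block groups -/

/-- A strictly increasing sequence `0 = k 0 < k 1 < ⋯` and, for each `n`, a group `D n` of even
permutations of the block `{k n, …, k (n + 1) - 1}`. -/
structure BlockData where
  /-- the end points of the blocks -/
  k : ℕ → ℕ
  strictMono_k : StrictMono k
  k_zero : k 0 = 0
  /-- the groups acting on the blocks -/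
  D : ∀ n, Subgroup (alternatingGroup (Finset.Ico (k n : ℤ) (k (n + 1) : ℤ)))

namespace BlockData

variable (B : BlockData)

/-- The block `{k n, …, k (n + 1) - 1}`. -/
noncomputable abbrev block (n : ℕ) : Finset ℤ := Finset.Ico (B.k n : ℤ) (B.k (n + 1) : ℤ)

/-- An element of `D n`, as a permutation of `ℤ` trivial outside of the `n`-th block. -/
noncomputable def extend (n : ℕ) : B.D n →* Equiv.Perm ℤ :=
  Equiv.Perm.ofSubtype.comp
    ((alternatingGroup (B.block n)).subtype.comp (B.D n).subtype)

/-- The index of the block containing `x`, if `0 ≤ x`. -/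
noncomputable def index (x : ℤ) : ℕ := Nat.findGreatest (fun n => (B.k n : ℤ) ≤ x) x.toNat

variable {B}

theorem index_eq {n : ℕ} {x : ℤ} (hx : x ∈ B.block n) : B.index x = n := by
  rw [Finset.mem_Ico] at hx
  have h1 := B.strictMono_k.le_apply (x := n)
  refine (Nat.findGreatest_eq_iff).2 ⟨by omega, fun _ => hx.1, fun m hm _ h => ?_⟩
  have := B.strictMono_k.monotone (Nat.succ_le_of_lt hm)
  simp only [Nat.succ_eq_add_one] at this
  omega

theorem mem_block_index {x : ℤ} (hx : 0 ≤ x) : x ∈ B.block (B.index x) := by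
  have h0 : (B.k 0 : ℤ) ≤ x := by rw [B.k_zero]; simpa using hx
  rw [Finset.mem_Ico]
  refine ⟨Nat.findGreatest_spec (P := fun n => (B.k n : ℤ) ≤ x) (Nat.zero_le _) h0, ?_⟩
  by_contra h
  rw [not_lt] at h
  have h1 := B.strictMono_k.le_apply (x := B.index x + 1)
  have h2 : B.index x + 1 ≤ x.toNat := by omega
  have h3 := Nat.le_findGreatest (P := fun n => (B.k n : ℤ) ≤ x) h2 h
  change B.index x + 1 ≤ B.index x at h3
  omega

theorem extend_mem {n : ℕ} (d : B.D n) {x : ℤ} (hx : x ∈ B.block n) :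
    B.extend n d x ∈ B.block n :=
  (Equiv.Perm.ofSubtype_apply_mem_iff_mem (p := (· ∈ B.block n)) _ x).2 hx

theorem extend_of_notMem {n : ℕ} (d : B.D n) {x : ℤ} (hx : x ∉ B.block n) :
    B.extend n d x = x :=
  Equiv.Perm.ofSubtype_apply_of_not_mem (p := (· ∈ B.block n)) _ hx

theorem index_extend (d : ∀ n, B.D n) (x : ℤ) :
    B.index (B.extend (B.index x) (d (B.index x)) x) = B.index x := by
  by_cases hx : x ∈ B.block (B.index x)
  · exact index_eq (extend_mem _ hx)
  · rw [extend_of_notMem _ hx]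

theorem extend_congr (d : ∀ n, B.D n) {m n : ℕ} (h : m = n) :
    B.extend m (d m) = B.extend n (d n) := by
  subst h
  rfl

variable (B)

/-- The inclusion of `∏ D n` in the permutations of `ℤ`: each `d n` acts on the `n`-th block, and
negative integers are fixed. -/
noncomputable def prodHom : (∀ n, B.D n) →* Equiv.Perm ℤ where
  toFun d :=
    { toFun := fun x => B.extend (B.index x) (d (B.index x)) x
      invFun := fun x => B.extend (B.index x) (d (B.index x))⁻¹ x
      left_inv := fun x => by
        have h := extend_congr d⁻¹ (index_extend d x)
        simp only [Pi.inv_apply] at h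
        beta_reduce
        rw [h, map_inv]
        exact (B.extend _ _).symm_apply_apply x
      right_inv := fun x => by
        have h := extend_congr d (index_extend d⁻¹ x)
        simp only [Pi.inv_apply] at h
        beta_reduce
        rw [h, map_inv]
        exact (B.extend _ _).apply_symm_apply x }
  map_one' := by ext x; simp
  map_mul' d e := by
    ext x
    simp only [Equiv.coe_fn_mk, Equiv.Perm.coe_mul, Function.comp_apply, Pi.mul_apply, map_mul]
    rw [extend_congr d (index_extend e x)]

theorem prodHom_apply_of_mem (d : ∀ n, B.D n) {n : ℕ} {x : ℤ} (hx : x ∈ B.block n) :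
    B.prodHom d x = B.extend n (d n) x := by
  change B.extend (B.index x) (d (B.index x)) x = _
  rw [extend_congr d (index_eq hx)]

theorem prodHom_apply_of_neg (d : ∀ n, B.D n) {x : ℤ} (hx : x < 0) : B.prodHom d x = x := by
  change B.extend (B.index x) (d (B.index x)) x = x
  refine extend_of_notMem (d (B.index x)) fun h => ?_
  rw [Finset.mem_Ico] at h
  omega

theorem prodHom_injective : Function.Injective B.prodHom := by
  intro d e h
  funext n
  apply Subtype.ext
  apply Subtype.ext
  apply Equiv.Perm.ofSubtype_injective (p := (· ∈ B.block n))
  change B.extend n (d n) = B.extend n (e n)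
  ext x
  by_cases hx : x ∈ B.block n
  · rw [← B.prodHom_apply_of_mem d hx, ← B.prodHom_apply_of_mem e hx, h]
  · rw [extend_of_notMem _ hx, extend_of_notMem _ hx]

/-- The group of permutations of `ℤ` generated by the finitary alternating group and `∏ D n`. -/
noncomputable def G : Subgroup (Equiv.Perm ℤ) :=
  Subgroup.closure ((finitaryAlternatingGroup ℤ : Set (Equiv.Perm ℤ)) ∪ Set.range B.prodHom)

/-- The inclusion of `∏ D n` in `G`. -/
noncomputable def prodToG : (∀ n, B.D n) →* B.G :=
  B.prodHom.codRestrict B.G fun d => Subgroup.subset_closure (Or.inr ⟨d, rfl⟩)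

/-- The subgroup `∏_{j ≥ n} D j` of `∏ D j`. -/
noncomputable def tail (n : ℕ) : Subgroup (∀ n, B.D n) := Subgroup.pi (Set.Iio n) fun _ => ⊥

variable {B}

theorem mem_tail {n : ℕ} {d : ∀ n, B.D n} : d ∈ B.tail n ↔ ∀ j < n, d j = 1 := by
  simp [tail, Subgroup.mem_pi]

theorem tail_anti {m n : ℕ} (h : m ≤ n) : B.tail n ≤ B.tail m := fun _ hd =>
  mem_tail.2 fun j hj => mem_tail.1 hd j (hj.trans_le h)

theorem prodHom_apply_of_lt {n : ℕ} {d : ∀ n, B.D n} (hd : d ∈ B.tail n) {x : ℤ}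
    (hx : x < B.k n) : B.prodHom d x = x := by
  rcases lt_or_ge x 0 with h | h
  · exact B.prodHom_apply_of_neg d h
  · have hm := mem_block_index (B := B) h
    rw [B.prodHom_apply_of_mem d hm, mem_tail.1 hd, map_one, Equiv.Perm.one_apply]
    by_contra hlt
    rw [not_lt] at hlt
    have := B.strictMono_k.monotone hlt
    rw [Finset.mem_Ico] at hm
    omega

/-- Every element of `G` normalizes all but finitely many of the groups `∏_{j ≥ n} D j`. -/
theorem exists_normalizes {g : Equiv.Perm ℤ} (hg : g ∈ B.G) :
    ∃ m, ∀ n ≥ m, ∀ v, v ∈ (B.tail n).map B.prodHom ↔ g * v * g⁻¹ ∈ (B.tail n).map B.prodHom := by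
  induction hg using Subgroup.closure_induction with
  | mem g hg =>
    rcases hg with ⟨s, σ, -, rfl⟩ | ⟨d, rfl⟩
    · obtain ⟨m, hm⟩ : ∃ m : ℕ, ∀ x ∈ s, x < m := by
        obtain ⟨b, hb⟩ := s.bddAbove
        exact ⟨b.toNat + 1, fun x hx => by have := hb hx; omega⟩
      have hcomm : ∀ n ≥ m, ∀ v ∈ (B.tail n).map B.prodHom,
          Commute (Equiv.Perm.ofSubtype σ) v := by
        rintro n hn _ ⟨d, hd, rfl⟩
        apply Equiv.Perm.Disjoint.commute
        intro x
        by_cases hx : x ∈ s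
        · right
          have h1 := B.strictMono_k.le_apply (x := n)
          have h2 := hm x hx
          exact prodHom_apply_of_lt hd (by omega)
        · left
          exact Equiv.Perm.ofSubtype_apply_of_not_mem _ hx
      refine ⟨m, fun n hn v => ⟨fun hv => ?_, fun hv => ?_⟩⟩
      · rw [(hcomm n hn v hv).eq, mul_inv_cancel_right]
        exact hv
      · have h := (hcomm n hn _ hv).eq
        have h2 : Equiv.Perm.ofSubtype σ * v * (Equiv.Perm.ofSubtype σ)⁻¹ = v := by
          have := congrArg (fun w => (Equiv.Perm.ofSubtype σ)⁻¹ * w) h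
          simpa [mul_assoc] using this
        rwa [h2] at hv
    · have key : ∀ n, ∀ e : ∀ n, B.D n, ∀ v ∈ (B.tail n).map B.prodHom,
          B.prodHom e * v * (B.prodHom e)⁻¹ ∈ (B.tail n).map B.prodHom := by
        rintro n e _ ⟨c, hc, rfl⟩
        refine ⟨e * c * e⁻¹, mem_tail.2 fun j hj => ?_, by simp⟩
        simp [mem_tail.1 hc j hj]
      refine ⟨0, fun n _ v => ⟨key n d v, fun hv => ?_⟩⟩
      have := key n d⁻¹ _ hv
      simpa [mul_assoc] using this
  | one => exact ⟨0, fun n _ v => by simp⟩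
  | mul x y _ _ hx hy =>
    obtain ⟨m, hm⟩ := hx
    obtain ⟨m', hm'⟩ := hy
    refine ⟨max m m', fun n hn v => ?_⟩
    rw [hm' n (le_of_max_le_right hn), hm n (le_of_max_le_left hn)]
    simp [mul_assoc]
  | inv x _ hx =>
    obtain ⟨m, hm⟩ := hx
    refine ⟨m, fun n hn v => ?_⟩
    rw [hm n hn (x⁻¹ * v * x⁻¹⁻¹)]
    simp [mul_assoc]

variable (B)

/-- The subgroups `∏_{j ≥ n} D j` of `G` form a basis of neighbourhoods of `1`. -/
@[reducible]
noncomputable def groupFilterBasis : GroupFilterBasis B.G where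
  sets := Set.range fun n => (((B.tail n).map B.prodToG : Subgroup B.G) : Set B.G)
  nonempty := Set.range_nonempty _
  inter_sets := by
    rintro _ _ ⟨m, rfl⟩ ⟨n, rfl⟩
    refine ⟨_, ⟨max m n, rfl⟩, Set.subset_inter ?_ ?_⟩
    · exact Subgroup.map_mono (tail_anti (le_max_left _ _))
    · exact Subgroup.map_mono (tail_anti (le_max_right _ _))
  one' := by
    rintro _ ⟨n, rfl⟩
    exact one_mem _
  mul' := by
    rintro _ ⟨n, rfl⟩
    refine ⟨_, ⟨n, rfl⟩, ?_⟩
    rintro _ ⟨x, hx, y, hy, rfl⟩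
    exact mul_mem (S := Subgroup B.G) hx hy
  inv' := by
    rintro _ ⟨n, rfl⟩
    exact ⟨_, ⟨n, rfl⟩, fun x hx => inv_mem (S := Subgroup B.G) hx⟩
  conj' := by
    rintro g _ ⟨n, rfl⟩
    obtain ⟨m, hm⟩ := exists_normalizes g.2
    refine ⟨_, ⟨max m n, rfl⟩, ?_⟩
    rintro _ ⟨d, hd, rfl⟩
    obtain ⟨e, he, h⟩ := (hm (max m n) (le_max_left _ _) _).1 ⟨d, hd, rfl⟩
    exact ⟨e, tail_anti (le_max_right _ _) he, Subtype.ext h⟩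

/-- The topology of `G`: the unique group topology for which the inclusion `∏ D n → G` is a
homeomorphism onto an open subgroup, see `isOpenEmbedding_prodToG` below. -/
noncomputable instance topology : TopologicalSpace B.G := B.groupFilterBasis.topology

instance isTopologicalGroup : IsTopologicalGroup B.G := B.groupFilterBasis.isTopologicalGroup

/-- The inclusion of `∏ D n`, with the product of the discrete topologies, in `G` is a
homeomorphism onto an open subgroup. -/
theorem isOpenEmbedding_prodToG [∀ n, TopologicalSpace (B.D n)]
    [∀ n, DiscreteTopology (B.D n)] : IsOpenEmbedding B.prodToG := by
  have hinj : Function.Injective B.prodToG := fun d e h =>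
    B.prodHom_injective (congrArg Subtype.val h)
  have hG := B.groupFilterBasis.nhds_one_hasBasis
  have htail : ∀ n, IsOpen (B.tail n : Set (∀ n, B.D n)) := fun n => by
    have : (B.tail n : Set (∀ n, B.D n)) = Set.pi (Set.Iio n) fun _ => {1} := by
      ext d
      simp [mem_tail]
    rw [this]
    exact isOpen_set_pi (Set.finite_Iio n) fun _ _ => isOpen_discrete _
  have hcont : Continuous B.prodToG := by
    apply continuous_of_continuousAt_one
    rw [ContinuousAt, map_one]
    refine hG.tendsto_right_iff.2 ?_
    rintro _ ⟨n, rfl⟩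
    filter_upwards [(htail n).mem_nhds (one_mem (B.tail n))] with d hd
    exact ⟨d, hd, rfl⟩
  refine .of_continuous_injective_isOpenMap hcont hinj ?_
  refine IsTopologicalGroup.isOpenMap_iff_nhds_one.2 ?_
  intro S hS
  rw [Filter.mem_map] at hS
  obtain ⟨O, hO, hOo, h1⟩ := mem_nhds_iff.1 hS
  obtain ⟨I, u, hu, hsub⟩ := isOpen_pi_iff.1 hOo 1 h1
  obtain ⟨N, hN⟩ := I.bddAbove
  refine hG.mem_iff.2 ⟨_, ⟨N + 1, rfl⟩, ?_⟩
  rintro _ ⟨d, hd, rfl⟩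
  refine hO (hsub fun j hj => ?_)
  rw [mem_tail.1 hd j (Nat.lt_succ_of_le (hN hj))]
  exact (hu j hj).2

/-- `G` is locally compact. -/
instance locallyCompactSpace : LocallyCompactSpace B.G := by
  let _ : ∀ n, TopologicalSpace (B.D n) := fun _ => ⊥
  have : ∀ n, DiscreteTopology (B.D n) := fun _ => ⟨rfl⟩
  have h := B.isOpenEmbedding_prodToG
  refine IsCompact.locallyCompactSpace_of_mem_nhds_of_group (isCompact_range h.continuous)
    (x := 1) ?_
  exact h.isOpen_range.mem_nhds ⟨1, map_one _⟩

end BlockData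

/-! Write `L` for the half-line below `k n`. The tail `∏_{j ≥ n} D j` is open and commutes with
`altOn L`, and every element of `G` is, for large `n`, a product of an even permutation of the
finite set `interval n` and a tail element. A closed subgroup `H` is studied through `trace H n`,
its image in `altOn L` modulo the tail. If the traces contain `altOn (interval n)` for large `n`,
then `H` is close to `G` in the Chabauty topology.

For URS's, let `X` be closed, invariant and without the trivial subgroup. Then some compact set
avoiding `1` meets every member of `X`, so for `H ∈ X` and large `n` the trace contains, for each `a
∈ altOn L`, an `a`-conjugate of an element of one fixed finite set of non-trivial permutations. By
the Hales–Jewett theorem (`exists_infinite_altOn_le`) the trace contains `altOn W` with `W ⊆ L`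
infinite. Conjugating `interval n` into `W` yields members of `X` arbitrarily close to `G`, so `G ∈
X`.

For finite covolume, the image of the tail in `G ⧸ H` has positive measure, since countably many
translates cover. Infinitely many translates cannot be disjoint, so the trace has finite index in
`altOn L`, hence is everything (`altOn_le_of_forall_exists_inv_mul_mem`). Then `H` is dense, and
being closed equals `G`. -/

namespace Equiv.Perm

/-! ### Finitely supported even permutations of a subset -/

variable {α : Type*} [DecidableEq α]

/-- The group of finitely supported even permutations of the subset `L` of `α`, generated by the
`3`-cycles with support in `L`. -/
def altOn (L : Set α) : Subgroup (Perm α) :=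
  Subgroup.closure {g | ∃ a ∈ L, ∃ b ∈ L, ∃ c ∈ L, a ≠ b ∧ b ≠ c ∧ a ≠ c ∧ swap a b * swap b c = g}

theorem altOn_le_iff {L : Set α} {K : Subgroup (Perm α)} :
    altOn L ≤ K ↔ ∀ a ∈ L, ∀ b ∈ L, ∀ c ∈ L, a ≠ b → b ≠ c → a ≠ c →
      swap a b * swap b c ∈ K := by
  rw [altOn, Subgroup.closure_le]
  constructor
  · intro h a ha b hb c hc hab hbc hac
    exact h ⟨a, ha, b, hb, c, hc, hab, hbc, hac, rfl⟩
  · rintro h _ ⟨a, ha, b, hb, c, hc, hab, hbc, hac, rfl⟩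
    exact h a ha b hb c hc hab hbc hac

theorem swap_mul_swap_mem_altOn {L : Set α} {a b c : α} (ha : a ∈ L) (hb : b ∈ L) (hc : c ∈ L)
    (hab : a ≠ b) (hbc : b ≠ c) (hac : a ≠ c) : swap a b * swap b c ∈ altOn L :=
  altOn_le_iff.1 le_rfl a ha b hb c hc hab hbc hac

theorem altOn_mono {L M : Set α} (h : L ⊆ M) : altOn L ≤ altOn M :=
  altOn_le_iff.2 fun _ ha _ hb _ hc => swap_mul_swap_mem_altOn (h ha) (h hb) (h hc)

theorem altOn_apply_of_notMem {L : Set α} {g : Perm α} (hg : g ∈ altOn L) {x : α} (hx : x ∉ L) :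
    g x = x := by
  have h : altOn L ≤ MulAction.stabilizer (Perm α) x := altOn_le_iff.2 fun a ha b hb c hc _ _ _ => by
    have hxa : x ≠ a := fun h => hx (h ▸ ha)
    have hxb : x ≠ b := fun h => hx (h ▸ hb)
    have hxc : x ≠ c := fun h => hx (h ▸ hc)
    rw [MulAction.mem_stabilizer_iff]
    change (swap a b * swap b c) x = x
    rw [mul_apply, swap_apply_of_ne_of_ne hxb hxc,
      swap_apply_of_ne_of_ne hxa hxb]
  exact h hg

/-- The alternating group of a finite set is generated by its 3-cycles; this reconciles `altOn` with
the description by even permutations of finite subsets. -/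
theorem ofSubtype_mem_altOn {L : Set α} {s : Finset α} (hs : ↑s ⊆ L) {σ : Perm s}
    (hσ : σ ∈ alternatingGroup s) : ofSubtype σ ∈ altOn L := by
  have h : alternatingGroup s ≤ (altOn L).comap (ofSubtype (p := (· ∈ s))) := by
    rw [← closure_three_cycles_eq_alternating, Subgroup.closure_le]
    intro g hg
    obtain ⟨a, ha⟩ : g.support.Nonempty := by
      rw [Finset.nonempty_iff_ne_empty, ne_eq, support_eq_empty_iff]
      exact hg.ne_one
    have hg3 := hg.nodup_iff_mem_support.2 ha
    rw [← hg.eq_swap_mul_swap_iff_mem_support] at ha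
    rw [SetLike.mem_coe, Subgroup.mem_comap, ha, map_mul, ofSubtype_swap_eq, ofSubtype_swap_eq]
    simp only [List.nodup_cons, List.mem_cons, List.not_mem_nil, or_false, not_or] at hg3
    refine swap_mul_swap_mem_altOn (hs a.2) (hs (g a).2) (hs (g (g a)).2) ?_ ?_ ?_ <;>
      rw [ne_eq, Subtype.coe_inj]
    exacts [hg3.1.1, hg3.2.1, hg3.1.2]
  exact h hσ

theorem altOn_le_finitaryAlternatingGroup (L : Set α) : altOn L ≤ finitaryAlternatingGroup α :=
  altOn_le_iff.2 fun a _ b _ c _ hab hbc hac => by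
    let s : Finset α := {a, b, c}
    let a' : s := ⟨a, by simp [s]⟩
    let b' : s := ⟨b, by simp [s]⟩
    let c' : s := ⟨c, by simp [s]⟩
    refine ⟨s, swap a' b' * swap b' c', ?_, ?_⟩
    · have h1 : a' ≠ b' := fun h => hab (congrArg Subtype.val h)
      have h2 : b' ≠ c' := fun h => hbc (congrArg Subtype.val h)
      rw [mem_alternatingGroup, map_mul, sign_swap h1, sign_swap h2]
      simp
    · rw [map_mul, ofSubtype_swap_eq, ofSubtype_swap_eq]

theorem finite_altOn {L : Set α} (hL : L.Finite) : (altOn L : Set (Perm α)).Finite := by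
  classical
  have h : altOn L ≤ (ofSubtype (p := (· ∈ L))).range := altOn_le_iff.2
    fun a ha b hb c hc hab hbc hac => by
      refine ⟨swap ⟨a, ha⟩ ⟨b, hb⟩ * swap ⟨b, hb⟩ ⟨c, hc⟩, ?_⟩
      rw [map_mul, ofSubtype_swap_eq, ofSubtype_swap_eq]
  have := hL.to_subtype
  exact (Set.finite_range (ofSubtype (p := (· ∈ L)))).subset h

theorem countable_finitaryAlternatingGroup [Countable α] :
    (finitaryAlternatingGroup α : Set (Perm α)).Countable := by
  refine (Set.countable_iUnion fun s : Finset α =>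
    (Set.finite_range (ofSubtype (p := (· ∈ s)))).countable).mono ?_
  rintro _ ⟨s, σ, -, rfl⟩
  exact Set.mem_iUnion.2 ⟨s, σ, rfl⟩

/-- An injection of a finite subset of an infinite set `L` in `L` extends to a finitely supported
even permutation of `L`. -/
theorem exists_mem_altOn_extend {L : Set α} (hL : L.Infinite) {T : Finset α} (hT : ↑T ⊆ L)
    {φ : T → α} (hφ : Function.Injective φ) (hφL : ∀ t, φ t ∈ L) :
    ∃ a ∈ altOn L, ∀ t : T, a t = φ t := by
  -- Two spare points outside `T`: composing with their transposition corrects the parity without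
  -- changing values on `T`.
  obtain ⟨u, huL, hu⟩ := (hL.sdiff T.finite_toSet).nonempty
  obtain ⟨v, ⟨hvL, hv⟩, huv⟩ := ((hL.sdiff T.finite_toSet).sdiff (Set.finite_singleton u)).nonempty
  let E : Finset α := T ∪ Finset.univ.image φ ∪ {u, v}
  have hE : ↑E ⊆ L := by
    intro x hx
    simp only [E, Finset.coe_union, Finset.coe_image, Finset.coe_univ, Finset.coe_insert,
      Finset.coe_singleton, Set.image_univ, Set.mem_union, Set.mem_range, Set.mem_insert_iff,
      Set.mem_singleton_iff] at hx
    rcases hx with (hx | ⟨t, rfl⟩) | rfl | rfl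
    exacts [hT hx, hφL t, huL, hvL]
  have hTE : ∀ t : T, (t : α) ∈ E := fun t => by simp [E]
  have hφE : ∀ t : T, φ t ∈ E := fun t => by
    simp only [E, Finset.mem_union, Finset.mem_image, Finset.mem_univ, true_and]
    exact Or.inl (Or.inr ⟨t, rfl⟩)
  let u' : E := ⟨u, by simp [E]⟩
  let v' : E := ⟨v, by simp [E]⟩
  have huv' : u' ≠ v' := fun h => huv (congrArg Subtype.val h).symm
  obtain ⟨σ, hσ⟩ := exists_extending_pair (fun t : T => (⟨t, hTE t⟩ : E)) (fun t => ⟨φ t, hφE t⟩)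
    (fun x y h => Subtype.ext (congrArg (fun z : E => (z : α)) h))
    (fun x y h => hφ (congrArg (fun z : E => (z : α)) h))
  obtain ⟨τ, hτ, hτσ⟩ : ∃ τ ∈ alternatingGroup E, ∀ t : T, τ ⟨t, hTE t⟩ = ⟨φ t, hφE t⟩ := by
    rcases Int.units_eq_one_or (sign σ) with h | h
    · exact ⟨σ, h, hσ⟩
    · refine ⟨σ * swap u' v', ?_, fun t => ?_⟩
      · rw [mem_alternatingGroup, map_mul, h, sign_swap huv']
        simp
      · rw [mul_apply, swap_apply_of_ne_of_ne, hσ]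
        · intro h
          have h : (t : α) = u := congrArg Subtype.val h
          exact hu (h ▸ t.2)
        · intro h
          have h : (t : α) = v := congrArg Subtype.val h
          exact hv (h ▸ t.2)
  refine ⟨ofSubtype τ, ofSubtype_mem_altOn hE hτ, fun t => ?_⟩
  rw [ofSubtype_apply_of_mem _ (hTE t), hτσ t]

theorem conj_swap_mul_swap (ρ : Perm α) (a b c : α) :
    ρ * (swap a b * swap b c) * ρ⁻¹ = swap (ρ a) (ρ b) * swap (ρ b) (ρ c) := by
  rw [swap_apply_apply, swap_apply_apply]
  group

theorem swap_mul_swap_rotate {a b c : α} (hab : a ≠ b) (hbc : b ≠ c) (hac : a ≠ c) :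
    swap a b * swap b c = swap b c * swap c a := by
  ext x
  simp only [mul_apply, swap_apply_def]
  grind

/-! ### The partition of the points defined by the 3-cycles of a subgroup -/

section Linked

variable (K : Subgroup (Perm α))

/-- Two points are linked by `K` if they are equal or if they belong to the support of a `3`-cycle
in `K`. -/
def Linked (a b : α) : Prop :=
  a = b ∨ ∃ c, a ≠ b ∧ b ≠ c ∧ a ≠ c ∧ swap a b * swap b c ∈ K

variable {K}

theorem swap_mul_swap_mem_symm {a b c : α} (h : swap a b * swap b c ∈ K) :
    swap c b * swap b a ∈ K := by
  have := inv_mem h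
  rwa [mul_inv_rev, swap_inv, swap_inv, swap_comm b c, swap_comm a b] at this

theorem swap_mul_swap_mem_conj {ρ : Perm α} (hρ : ρ ∈ K) {a b c : α}
    (h : swap a b * swap b c ∈ K) : swap (ρ a) (ρ b) * swap (ρ b) (ρ c) ∈ K := by
  rw [← conj_swap_mul_swap]
  exact mul_mem (mul_mem hρ h) (inv_mem hρ)

theorem Linked.symm {a b : α} (h : Linked K a b) : Linked K b a := by
  rcases h with rfl | ⟨c, hab, hbc, hac, h⟩
  · exact Or.inl rfl
  · refine Or.inr ⟨c, hab.symm, hac, hbc, ?_⟩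
    have := swap_mul_swap_mem_symm h
    rwa [swap_mul_swap_rotate hbc.symm hab.symm hac.symm] at this

/-- Given 3-cycles on `a, b, x` and on `b, c, y` with `x ≠ c`, the inverse of the first carries `b`
to `a` and fixes `c`; it conjugates the second to a 3-cycle through `a` and `c`. -/
theorem Linked.trans {a b c : α} (h₁ : Linked K a b) (h₂ : Linked K b c) : Linked K a c := by
  rcases h₁ with rfl | ⟨x, hab, hbx, hax, h₁⟩
  · exact h₂
  rcases h₂ with rfl | ⟨y, hbc, hcy, hby, h₂⟩
  · exact Or.inr ⟨x, hab, hbx, hax, h₁⟩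
  by_cases hac : a = c
  · exact Or.inl hac
  refine Or.inr ?_
  by_cases hxc : x = c
  · subst hxc
    refine ⟨b, hac, hbc.symm, hab, ?_⟩
    rw [swap_mul_swap_rotate hac hbx.symm hab]
    exact swap_mul_swap_mem_symm h₁
  · have h := swap_mul_swap_mem_conj (swap_mul_swap_mem_symm h₁) h₂
    have e1 : (swap x b * swap b a) b = a := by
      rw [mul_apply, swap_apply_left, swap_apply_of_ne_of_ne hax hab]
    have e2 : (swap x b * swap b a) c = c := by
      rw [mul_apply, swap_apply_of_ne_of_ne hbc.symm (Ne.symm hac),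
        swap_apply_of_ne_of_ne (Ne.symm hxc) hbc.symm]
    refine ⟨(swap x b * swap b a) y, hac, ?_, ?_, ?_⟩
    · exact fun h => hcy ((swap x b * swap b a).injective (e2.trans h))
    · exact fun h => hby ((swap x b * swap b a).injective (e1.trans h))
    · rwa [e1, e2] at h

variable (K) in
/-- Being linked by `K`, as an equivalence relation. -/
def linkedSetoid : Setoid α where
  r := Linked K
  iseqv := ⟨fun _ => Or.inl rfl, Linked.symm, Linked.trans⟩

/-- So `K` contains every 3-cycle inside a class. The 3-cycle on `a, b, x` is conjugated by one on
`x, c, z`, which puts `c` in place of `x`. If `z` is `a` or `b`, the inverse conjugator is used, so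
that the resulting support is still `{a, b, c}`. -/
theorem swap_mul_swap_mem_of_linked {a b c : α} (hab : a ≠ b) (hbc : b ≠ c) (hac : a ≠ c)
    (h₁ : Linked K a b) (h₂ : Linked K a c) : swap a b * swap b c ∈ K := by
  rcases h₁ with rfl | ⟨x, -, hbx, hax, h₁⟩
  · exact absurd rfl hab
  by_cases hxc : x = c
  · rwa [← hxc]
  have h₃ : Linked K x c := by
    refine Linked.trans (Or.inr ⟨b, hax.symm, hab, hbx.symm, ?_⟩) h₂
    rwa [swap_mul_swap_rotate hax.symm hab hbx.symm]
  rcases h₃ with h₃ | ⟨z, -, hcz, hxz, h₃⟩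
  · exact absurd h₃ hxc
  by_cases hza : z = a
  · subst hza
    have := swap_mul_swap_mem_conj (swap_mul_swap_mem_symm h₃) h₁
    have e1 : (swap z c * swap c x) z = c := by
      rw [mul_apply, swap_apply_of_ne_of_ne hac hax, swap_apply_left]
    have e2 : (swap z c * swap c x) b = b := by
      rw [mul_apply, swap_apply_of_ne_of_ne hbc hbx, swap_apply_of_ne_of_ne hab.symm hbc]
    have e3 : (swap z c * swap c x) x = z := by
      rw [mul_apply, swap_apply_right, swap_apply_right]
    rw [e1, e2, e3] at this
    exact swap_mul_swap_mem_symm this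
  by_cases hzb : z = b
  · subst hzb
    have := swap_mul_swap_mem_conj (swap_mul_swap_mem_symm h₃) h₁
    have e1 : (swap z c * swap c x) z = c := by
      rw [mul_apply, swap_apply_of_ne_of_ne hbc hbx, swap_apply_left]
    have e2 : (swap z c * swap c x) a = a := by
      rw [mul_apply, swap_apply_of_ne_of_ne hac hax, swap_apply_of_ne_of_ne hab hac]
    have e3 : (swap z c * swap c x) x = z := by
      rw [mul_apply, swap_apply_right, swap_apply_right]
    rw [e1, e2, e3] at this
    rw [swap_mul_swap_rotate hab hbc hac]
    exact swap_mul_swap_mem_symm this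
  · have := swap_mul_swap_mem_conj h₃ h₁
    have e1 : (swap x c * swap c z) a = a := by
      rw [mul_apply, swap_apply_of_ne_of_ne hac (Ne.symm hza), swap_apply_of_ne_of_ne hax hac]
    have e2 : (swap x c * swap c z) b = b := by
      rw [mul_apply, swap_apply_of_ne_of_ne hbc (Ne.symm hzb), swap_apply_of_ne_of_ne hbx hbc]
    have e3 : (swap x c * swap c z) x = c := by
      rw [mul_apply, swap_apply_of_ne_of_ne hxc hxz, swap_apply_left]
    rwa [e1, e2, e3] at this

end Linked

/-! ### Subgroups meeting all conjugates of a finite set -/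

/-- A subgroup containing a conjugate of one of finitely many non-trivial permutations, for every
conjugator in `altOn L`, contains `altOn W` for some infinite subset `W` of `L`. -/
theorem exists_infinite_altOn_le {L : Set α} (hL : L.Infinite) {T : Finset α} (hT : ↑T ⊆ L)
    {F : Set (Perm α)} (hF : F.Finite) (hF1 : 1 ∉ F) (hFT : ∀ g ∈ F, ∀ x ∉ T, g x = x)
    {K : Subgroup (Perm α)} (hK : ∀ a ∈ altOn L, ∃ g ∈ F, a * g * a⁻¹ ∈ K) :
    ∃ W ⊆ L, W.Infinite ∧ altOn W ≤ K := by
  let q : L → Quotient (linkedSetoid K) := fun x => Quotient.mk _ (x : α)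
  have := hL.to_subtype
  have := hF.to_subtype
  -- With finitely many classes on `L`, one is infinite and serves as `W`. Infinitely many classes
  -- lead to a contradiction.
  rcases finite_or_infinite (Set.range q) with hfin | hinf
  · obtain ⟨⟨y, hy⟩, hyinf⟩ := Finite.exists_infinite_fiber (Set.rangeFactorization q)
    rw [Set.infinite_coe_iff] at hyinf
    refine ⟨_, ?_, hyinf.image (Subtype.val_injective.injOn), ?_⟩
    · rintro _ ⟨x, -, rfl⟩
      exact x.2
    · have key : ∀ a b : L, a ∈ Set.rangeFactorization q ⁻¹' {⟨y, hy⟩} →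
          b ∈ Set.rangeFactorization q ⁻¹' {⟨y, hy⟩} → Linked K a b := by
        intro a b ha hb
        have h : q a = q b := congrArg Subtype.val (ha.trans hb.symm)
        exact Quotient.exact (s := linkedSetoid K) h
      rw [altOn_le_iff]
      rintro _ ⟨a, ha, rfl⟩ _ ⟨b, hb, rfl⟩ _ ⟨c, hc, rfl⟩ hab hbc hac
      exact swap_mul_swap_mem_of_linked hab hbc hac (key a b ha hb) (key a c ha hc)
  · exfalso
    -- Hales–Jewett with alphabet `T → Bool`: a letter gives one bit to each point of `T`, so a word
    -- gives each `t` its own bit string. The permutation `a w` sends `t` to a point labelled by `t`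
    -- and its string, distinct labels being unlinked. The colour of `w` is an element of `F` whose
    -- `a w`-conjugate lies in `K`.
    obtain ⟨ι, _, hι⟩ := Combinatorics.Line.exists_mono_in_high_dimension (T → Bool) F
    obtain ⟨f⟩ : Nonempty (T × (ι → Bool) ↪ Set.range q) :=
      ⟨(Function.Embedding.refl _).trans ((Finite.equivFin _).toEmbedding.trans
        (Fin.valEmbedding.trans (Infinite.natEmbedding _)))⟩
    let e : T × (ι → Bool) → L := fun z => Classical.choose (f z).2
    have he : ∀ z, q (e z) = f z := fun z => Classical.choose_spec (f z).2
    have hlink : ∀ z z', Linked K (e z : α) (e z') → z = z' := fun z z' h => by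
      apply f.injective
      apply Subtype.ext
      rw [← he, ← he]
      exact Quotient.sound (s := linkedSetoid K) h
    have hinj : ∀ z z', (e z : α) = e z' → z = z' := fun z z' h => hlink z z' (Or.inl h)
    have hext : ∀ w : ι → T → Bool, ∃ a ∈ altOn L, ∀ t : T, a t = e (t, fun i => w i t) := fun w =>
      exists_mem_altOn_extend hL hT (fun t t' h => congrArg Prod.fst (hinj _ _ h)) fun t => (e _).2
    choose a haL ha using hext
    choose c hcF hcK using fun w => hK (a w) (haL w)
    obtain ⟨l, ⟨g, hgF⟩, hl⟩ := hι fun w => ⟨c w, hcF w⟩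
    have hg : ∀ x, a (l x) * g * (a (l x))⁻¹ ∈ K := fun x => by
      have h := congrArg Subtype.val (hl x)
      simp only at h
      rw [← h]
      exact hcK (l x)
    obtain ⟨t, ht⟩ : ∃ t, g t ≠ t := by
      by_contra! h
      exact hF1 ((Equiv.ext h : g = 1) ▸ hgF)
    have htT : t ∈ T := by
      by_contra h
      exact ht (hFT g hgF t h)
    have hgT : g t ∈ T := by
      by_contra h
      exact ht (g.injective (hFT g hgF _ h))
    -- Two letters differing only in the bit of `t`: the corresponding points of the line give
    -- permutations that agree on `T` except at `t`, a point moved by the colour `g`.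
    let x : T → Bool := fun _ => false
    let x' : T → Bool := Function.update x ⟨t, htT⟩ true
    have hag : ∀ s : T, (s : α) ≠ t → a (l x') s = a (l x) s := by
      intro s hs
      have hxx : x' s = x s := Function.update_of_ne (fun h => hs (congrArg Subtype.val h)) _ _
      rw [ha, ha]
      congr 3
      funext i
      simp only [Combinatorics.Line.coe_apply]
      cases l.idxFun i with
      | none => exact hxx
      | some y => rfl
    have huv : a (l x) t ≠ a (l x') t := by
      intro h
      have h1 := ha (l x) ⟨t, htT⟩
      have h2 := ha (l x') ⟨t, htT⟩
      have h3 := congrArg Prod.snd (hinj _ _ ((h1.symm.trans h).trans h2))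
      obtain ⟨i, hi⟩ := l.proper
      have h4 := congrFun h3 i
      simp only [Combinatorics.Line.coe_apply, hi, Option.getD_none, x', x,
        Function.update_self] at h4
      exact absurd h4 (by decide)
    have hv : ∀ s : T, a (l x) s ≠ a (l x') t := by
      intro s hs
      by_cases hst : (s : α) = t
      · exact huv (hst ▸ hs)
      · rw [← hag s hst] at hs
        exact hst ((a (l x')).injective hs)
    set u := a (l x) t with hu
    set v := a (l x') t with hv'
    set s := a (l x) * g * (a (l x))⁻¹ with hs
    have hsu : s u = a (l x) (g t) := by simp [hs, hu]
    have hsv : s v = v := by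
      have : (a (l x))⁻¹ v ∉ T := fun h => hv ⟨_, h⟩ (by simp)
      rw [hs, mul_apply, mul_apply, hFT g hgF _ this]
      simp
    -- On `T` the permutation `a (l x')` equals `swap u v * a (l x)`; the discrepancy fixes `T`
    -- pointwise, hence commutes with `g`.
    have hconj : a (l x') * g * (a (l x'))⁻¹ = swap u v * s * swap u v := by
      have h1 : ∀ z ∈ T, a (l x') z = swap u v (a (l x) z) := by
        intro z hz
        by_cases hzt : z = t
        · rw [hzt, ← hu, ← hv', swap_apply_left]
        · rw [hag ⟨z, hz⟩ hzt, swap_apply_of_ne_of_ne]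
          · exact fun h => hzt ((a (l x)).injective h)
          · exact hv ⟨z, hz⟩
      have h2 : (swap u v * a (l x))⁻¹ * a (l x') * g = g * ((swap u v * a (l x))⁻¹ * a (l x')) := by
        have h3 : ∀ z ∈ T, ((swap u v * a (l x))⁻¹ * a (l x')) z = z := fun z hz => by
          rw [mul_apply, h1 z hz, ← mul_apply (swap u v), ← mul_apply, inv_mul_cancel, one_apply]
        refine (Disjoint.commute fun z => ?_).eq
        by_cases hz : z ∈ T
        · exact Or.inl (h3 z hz)
        · exact Or.inr (hFT g hgF z hz)
      have h4 : (swap u v)⁻¹ = swap u v := swap_inv u v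
      calc a (l x') * g * (a (l x'))⁻¹
          = (swap u v * a (l x)) * ((swap u v * a (l x))⁻¹ * a (l x') * g) * (a (l x'))⁻¹ := by group
        _ = swap u v * s * (swap u v)⁻¹ := by rw [h2, hs]; group
        _ = _ := by rw [h4]
    -- The commutator of `swap u v` and `s`. As `s` fixes `v` and moves `u` to a third point, it is
    -- a 3-cycle, which links `u` and `v` despite their different labels.
    have hmem : swap u v * swap v (s u) ∈ K := by
      have h1 := mul_mem (hg x') (inv_mem (hg x))
      rw [hconj, ← hs, mul_assoc, mul_assoc, ← mul_assoc s, ← swap_apply_apply, hsv,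
        swap_comm (s u)] at h1
      exact h1
    have huw : u ≠ s u := by
      rw [hsu]
      exact fun h => ht ((a (l x)).injective h).symm
    have hvw : v ≠ s u := by
      rw [hsu]
      exact (hv ⟨_, hgT⟩).symm
    have h : Linked K u v := Or.inr ⟨s u, huv, hvw, huw, hmem⟩
    rw [hu, hv', ha (l x) ⟨t, htT⟩, ha (l x') ⟨t, htT⟩] at h
    refine huv ?_
    rw [hu, hv', ha (l x) ⟨t, htT⟩, ha (l x') ⟨t, htT⟩, hlink _ _ h]

/-! ### Finite-index subgroups of an infinite alternating group -/

/-- A subgroup of which every sequence in `altOn L` meets some left coset twice contains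
`altOn L`. -/
theorem altOn_le_of_forall_exists_inv_mul_mem {L : Set α} (hL : L.Infinite) {K : Subgroup (Perm α)}
    (hK : ∀ x : ℕ → Perm α, (∀ i, x i ∈ altOn L) → ∃ i j, i ≠ j ∧ (x i)⁻¹ * x j ∈ K) :
    altOn L ≤ K := by
  let N := K.subgroupOf (altOn L)
  have hN : N.FiniteIndex := by
    rw [Subgroup.finiteIndex_iff_finite_quotient]
    by_contra h
    rw [not_finite_iff_infinite] at h
    let y := Infinite.natEmbedding (altOn L ⧸ N)
    obtain ⟨i, j, hij, h⟩ := hK (fun i => ((y i).out : altOn L)) fun i => SetLike.coe_mem _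
    refine hij (y.injective ?_)
    rw [← QuotientGroup.out_eq' (y i), ← QuotientGroup.out_eq' (y j)]
    exact QuotientGroup.eq.2 h
  obtain ⟨a, haL⟩ := hL.nonempty
  obtain ⟨b, hbL, hba⟩ := (hL.sdiff (Set.finite_singleton a)).nonempty
  have hab : a ≠ b := Ne.symm hba
  have hL' := hL.sdiff (Set.toFinite {a, b})
  have := hL'.to_subtype
  -- Infinitely many 3-cycles in a finite quotient: two coincide, and their quotient is a 3-cycle in
  -- the normal core. Its conjugates under `altOn L` are all the 3-cycles of `L`.
  let w : ↥(L \ {a, b}) → altOn L ⧸ N.normalCore := fun z =>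
    QuotientGroup.mk ⟨swap a b * swap b z, swap_mul_swap_mem_altOn haL hbL z.2.1 hab
      (fun h => z.2.2 (by simp [← h])) (fun h => z.2.2 (by simp [← h]))⟩
  have : Finite (altOn L ⧸ N.normalCore) := Subgroup.finite_quotient_of_finiteIndex
  obtain ⟨z, z', hzz, h⟩ := Finite.exists_ne_map_eq_of_infinite w
  have hzb : (z : α) ≠ b := fun h => z.2.2 (by simp [h])
  have hzb' : b ≠ z' := fun h => z'.2.2 (by simp [← h])
  have hzz' : (z : α) ≠ z' := fun h => hzz (Subtype.ext h)
  have hcore := QuotientGroup.eq.1 h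
  have hcalc : (swap a b * swap b (z : α))⁻¹ * (swap a b * swap b z') = swap (z : α) b * swap b z' := by
    rw [mul_inv_rev, swap_inv, swap_inv, mul_assoc, swap_mul_self_mul, swap_comm b (z : α)]
  rw [altOn_le_iff]
  intro x hx y hy t ht hxy hyt hxt
  obtain ⟨ρ, hρ, hρe⟩ := exists_mem_altOn_extend hL (T := {(z : α), b, (z' : α)})
    (φ := fun s => if (s : α) = z then x else if (s : α) = b then y else t)
    (by
      intro s hs
      simp only [Finset.coe_insert, Finset.coe_singleton, Set.mem_insert_iff,
        Set.mem_singleton_iff] at hs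
      rcases hs with rfl | rfl | rfl
      exacts [z.2.1, hbL, z'.2.1])
    (by
      rintro ⟨s, hs⟩ ⟨s', hs'⟩ h
      simp only [Finset.mem_insert, Finset.mem_singleton] at hs hs'
      grind)
    (fun s => by split_ifs <;> assumption)
  have e1 : ρ z = x := by simpa using hρe ⟨z, by simp⟩
  have e2 : ρ b = y := by simpa [hzb.symm] using hρe ⟨b, by simp⟩
  have e3 : ρ z' = t := by simpa [hzz'.symm, hzb'.symm] using hρe ⟨z', by simp⟩
  have := N.normalCore_le ((N.normalCore_normal).conj_mem _ hcore ⟨ρ, hρ⟩)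
  rw [Subgroup.mem_subgroupOf] at this
  simp only [Subgroup.coe_mul, InvMemClass.coe_inv] at this
  rwa [hcalc, conj_swap_mul_swap, e1, e2, e3] at this

end Equiv.Perm

/-! ### Levels of the group and its topology -/

namespace BlockData

open Equiv.Perm

variable (B : BlockData)

/-- The interval `{-n, …, k n - 1}`. -/
abbrev interval (n : ℕ) : Set ℤ := Set.Ico (-n : ℤ) (B.k n)

variable {B}

theorem k_mono {m n : ℕ} (h : m ≤ n) : (B.k m : ℤ) ≤ B.k n :=
  Int.ofNat_le.2 (B.strictMono_k.monotone h)

theorem interval_subset_Iio (n : ℕ) : B.interval n ⊆ Set.Iio (B.k n : ℤ) := fun _ hx => hx.2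

theorem interval_mono {m n : ℕ} (h : m ≤ n) : B.interval m ⊆ B.interval n :=
  Set.Ico_subset_Ico (by omega) (k_mono h)

theorem commute_prodHom {n : ℕ} {a : Equiv.Perm ℤ} (ha : a ∈ altOn (Set.Iio (B.k n : ℤ)))
    {d : ∀ n, B.D n} (hd : d ∈ B.tail n) : Commute a (B.prodHom d) :=
  Disjoint.commute fun x => by
    by_cases hx : x < B.k n
    · exact Or.inr (prodHom_apply_of_lt hd hx)
    · exact Or.inl (altOn_apply_of_notMem ha hx)

theorem extend_mem_altOn (n : ℕ) (d : B.D n) : B.extend n d ∈ altOn (B.block n : Set ℤ) :=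
  ofSubtype_mem_altOn subset_rfl (d : alternatingGroup (B.block n)).2

theorem prodHom_mulSingle (n : ℕ) (d : B.D n) :
    B.prodHom (Pi.mulSingle n d) = B.extend n d := by
  ext x
  by_cases hx : x ∈ B.block n
  · rw [prodHom_apply_of_mem _ _ hx, Pi.mulSingle_eq_same]
  · rw [extend_of_notMem _ hx]
    rcases lt_or_ge x 0 with h | h
    · exact prodHom_apply_of_neg _ _ h
    · have hm := mem_block_index (B := B) h
      have hne : B.index x ≠ n := fun h => hx (h ▸ hm)
      rw [prodHom_apply_of_mem _ _ hm, Pi.mulSingle_eq_of_ne hne, map_one, one_apply]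

variable (B) in
/-- The subgroup of the products of an even permutation of `{-n, …, k n - 1}` and an element of
`∏_{j ≥ n} D j`. -/
noncomputable def level (n : ℕ) : Subgroup (Equiv.Perm ℤ) where
  carrier := {g | ∃ a ∈ altOn (B.interval n), ∃ d ∈ B.tail n, a * B.prodHom d = g}
  one_mem' := ⟨1, one_mem _, 1, one_mem _, by simp⟩
  mul_mem' := by
    rintro _ _ ⟨a, ha, d, hd, rfl⟩ ⟨b, hb, e, he, rfl⟩
    refine ⟨a * b, mul_mem ha hb, d * e, mul_mem hd he, ?_⟩
    have h := (commute_prodHom (altOn_mono (interval_subset_Iio n) hb) hd).eq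
    rw [map_mul, mul_assoc, ← mul_assoc b, h]
    simp only [mul_assoc]
  inv_mem' := by
    rintro _ ⟨a, ha, d, hd, rfl⟩
    refine ⟨a⁻¹, inv_mem ha, d⁻¹, inv_mem hd, ?_⟩
    have h := (commute_prodHom (altOn_mono (interval_subset_Iio n) (inv_mem ha)) (inv_mem hd)).eq
    rw [h, map_inv, mul_inv_rev]

/-- The component of a tail element in block `n` is an even permutation of that block, so it can be
moved to the finitary factor. -/
theorem level_mono : Monotone B.level := by
  refine monotone_nat_of_le_succ fun n => ?_
  rintro _ ⟨a, ha, d, hd, rfl⟩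
  refine ⟨a * B.extend n (d n), mul_mem (altOn_mono (interval_mono n.le_succ) ha)
    (altOn_mono (fun x hx => ?_) (extend_mem_altOn n (d n))), (Pi.mulSingle n (d n))⁻¹ * d,
    mem_tail.2 fun j hj => ?_, ?_⟩
  · rw [Finset.mem_coe, Finset.mem_Ico] at hx
    exact ⟨by omega, hx.2⟩
  · rcases (Nat.lt_succ_iff_lt_or_eq.1 hj) with h | rfl
    · simp [Pi.mulSingle_eq_of_ne h.ne, mem_tail.1 hd j h]
    · simp
  · rw [map_mul, map_inv, prodHom_mulSingle]
    group

theorem exists_mem_level {g : Equiv.Perm ℤ} (hg : g ∈ B.G) : ∃ n, g ∈ B.level n := by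
  induction hg using Subgroup.closure_induction with
  | mem g hg =>
    rcases hg with ⟨s, σ, hσ, rfl⟩ | ⟨d, rfl⟩
    · obtain ⟨b, hb⟩ := s.bddAbove
      obtain ⟨c, hc⟩ := s.bddBelow
      -- This index `n` satisfies `-n ≤ c` and `b < n ≤ k n`, so `interval n` contains `s`.
      refine ⟨b.toNat + 1 + (-c).toNat, ofSubtype σ, ofSubtype_mem_altOn (fun x hx => ?_) hσ, 1,
        one_mem _, by simp⟩
      have h1 := hb hx
      have h2 := hc hx
      have h3 := B.strictMono_k.le_apply (x := b.toNat + 1 + (-c).toNat)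
      constructor <;> omega
    · exact ⟨0, 1, one_mem _, d, mem_tail.2 fun j hj => absurd hj (Nat.not_lt_zero j), by simp⟩
  | one => exact ⟨0, one_mem _⟩
  | mul x y _ _ hx hy =>
    obtain ⟨m, hm⟩ := hx
    obtain ⟨n, hn⟩ := hy
    exact ⟨max m n, mul_mem (level_mono (le_max_left m n) hm) (level_mono (le_max_right m n) hn)⟩
  | inv x _ hx =>
    obtain ⟨m, hm⟩ := hx
    exact ⟨m, inv_mem hm⟩

theorem altOn_le_G (L : Set ℤ) : altOn L ≤ B.G :=
  (altOn_le_finitaryAlternatingGroup L).trans fun _ h => Subgroup.subset_closure (Or.inl h)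

@[simp]
theorem coe_prodToG (d : ∀ n, B.D n) : (B.prodToG d : Equiv.Perm ℤ) = B.prodHom d := rfl

theorem map_tail_mem_nhds_one (n : ℕ) :
    ((B.tail n).map B.prodToG : Set B.G) ∈ 𝓝 (1 : B.G) :=
  B.groupFilterBasis.nhds_one_hasBasis.mem_of_mem ⟨n, rfl⟩

theorem isOpen_map_tail (n : ℕ) : IsOpen ((B.tail n).map B.prodToG : Set B.G) :=
  Subgroup.isOpen_of_mem_nhds _ (map_tail_mem_nhds_one n)

theorem exists_tail_subset {g : B.G} {V : Set B.G} (hV : V ∈ 𝓝 g) :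
    ∃ N, ∀ n ≥ N, ∀ d ∈ B.tail n, g * B.prodToG d ∈ V := by
  have h : (fun x => g * x) ⁻¹' V ∈ 𝓝 (1 : B.G) :=
    (continuous_const_mul g).continuousAt.preimage_mem_nhds (by simpa using hV)
  obtain ⟨_, ⟨N, rfl⟩, hN⟩ := B.groupFilterBasis.nhds_one_hasBasis.mem_iff.1 h
  exact ⟨N, fun n hn d hd => hN ⟨d, tail_anti hn hd, rfl⟩⟩

theorem isOpen_level (n : ℕ) : IsOpen ((B.level n).subgroupOf B.G : Set B.G) := by
  refine Subgroup.isOpen_of_mem_nhds _ (Filter.mem_of_superset (map_tail_mem_nhds_one n) ?_)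
  rintro _ ⟨d, hd, rfl⟩
  exact ⟨1, one_mem _, d, hd, by simp⟩

/-- The levels form an increasing open cover of `G`. -/
theorem exists_subset_level {C : Set B.G} (hC : IsCompact C) :
    ∃ N, ∀ n ≥ N, ∀ c ∈ C, (c : Equiv.Perm ℤ) ∈ B.level n := by
  obtain ⟨N, hN⟩ := hC.elim_directed_cover
    (fun n => ((B.level n).subgroupOf B.G : Set B.G)) isOpen_level
    (fun c _ => Set.mem_iUnion.2 (exists_mem_level c.2))
    (Monotone.directed_le fun m n hmn c hc => level_mono hmn hc)
  exact ⟨N, fun n hn c hc => level_mono hn (hN hc)⟩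

instance t2Space : T2Space B.G := by
  refine IsTopologicalGroup.t2Space_of_one_sep fun g hg => ?_
  obtain ⟨x, hx⟩ : ∃ x, (g : Equiv.Perm ℤ) x ≠ x := by
    by_contra! h
    exact hg (Subtype.ext (Equiv.ext h))
  refine ⟨_, map_tail_mem_nhds_one (x.toNat + 1), ?_⟩
  rintro ⟨d, hd, rfl⟩
  have h := B.strictMono_k.le_apply (x := x.toNat + 1)
  exact hx (prodHom_apply_of_lt hd (by omega))

/-! ### Traces of subgroups -/

/-- The even permutations of `{x | x < k n}` that belong to a subgroup of `G` modulo
`∏_{j ≥ n} D j`. -/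
noncomputable def trace (H : Subgroup B.G) (n : ℕ) : Subgroup (Equiv.Perm ℤ) where
  carrier := {a | a ∈ altOn (Set.Iio (B.k n : ℤ)) ∧
    ∃ d ∈ B.tail n, a * B.prodHom d ∈ H.map B.G.subtype}
  one_mem' := ⟨one_mem _, 1, one_mem _, by rw [map_one, mul_one]; exact one_mem _⟩
  mul_mem' := by
    rintro a b ⟨ha, d, hd, had⟩ ⟨hb, e, he, hbe⟩
    refine ⟨mul_mem ha hb, d * e, mul_mem hd he, ?_⟩
    have h := (commute_prodHom hb hd).eq
    have := mul_mem had hbe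
    rwa [mul_assoc, ← mul_assoc (B.prodHom d), ← h, mul_assoc b, ← mul_assoc, ← map_mul] at this
  inv_mem' := by
    rintro a ⟨ha, d, hd, had⟩
    refine ⟨inv_mem ha, d⁻¹, inv_mem hd, ?_⟩
    have h := (commute_prodHom (inv_mem ha) (inv_mem hd)).eq
    rw [h, map_inv, ← mul_inv_rev]
    exact inv_mem had

/-- A point `v` of `V` is `a` times a tail element; the trace condition puts `a` times some other
tail element in `H`. The two differ by a tail element, which for large `n` does not lead out of `V`.
The bound `N` is uniform in `H`, as the Chabauty argument requires. -/
theorem exists_inter_nonempty {V : Set B.G} (hV : IsOpen V) (hne : V.Nonempty) :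
    ∃ N, ∀ n ≥ N, ∀ H : Subgroup B.G, altOn (B.interval n) ≤ trace H n →
      ((H : Set B.G) ∩ V).Nonempty := by
  obtain ⟨v, hv⟩ := hne
  obtain ⟨N, hN⟩ := exists_mem_level v.2
  obtain ⟨M, hM⟩ := exists_tail_subset (hV.mem_nhds hv)
  refine ⟨max N M, fun n hn H hH => ?_⟩
  obtain ⟨a, ha, d, hd, hv'⟩ := level_mono ((le_max_left N M).trans hn) hN
  obtain ⟨-, e, he, h, hh, hae⟩ := hH ha
  refine ⟨h, hh, ?_⟩
  have := hM n ((le_max_right N M).trans hn) (d⁻¹ * e) (mul_mem (inv_mem hd) he)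
  convert this using 1
  apply Subtype.ext
  change (h : Equiv.Perm ℤ) = v * B.prodHom (d⁻¹ * e)
  rw [← hv', map_mul, map_inv]
  change (h : Equiv.Perm ℤ) = _ at hae
  rw [hae]
  group

theorem mem_map_conj_iff {H : ClosedSubgroup B.G} {g : B.G} {x : Equiv.Perm ℤ} :
    x ∈ ((H.conj g : ClosedSubgroup B.G) : Subgroup B.G).map B.G.subtype ↔
      (g : Equiv.Perm ℤ)⁻¹ * x * g ∈ (H : Subgroup B.G).map B.G.subtype := by
  constructor
  · rintro ⟨_, ⟨h, hh, rfl⟩, rfl⟩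
    refine ⟨h, hh, ?_⟩
    simp [mul_assoc]
  · rintro ⟨h, hh, hx⟩
    refine ⟨_, ⟨h, hh, rfl⟩, ?_⟩
    simp only [Subgroup.coe_subtype] at hx
    simp [hx, mul_assoc]

/-- Some `b ∈ altOn (Set.Iio (B.k n : ℤ))` maps the finite `interval n` into `W`. Conjugation by
`b⁻¹` pulls the 3-cycles back and leaves the tail factor alone, because `b` commutes with it. -/
theorem exists_conj_altOn_le_trace {H : ClosedSubgroup B.G} {n : ℕ} {W : Set ℤ}
    (hW : W.Infinite) (hWL : W ⊆ Set.Iio (B.k n : ℤ)) (h : altOn W ≤ trace (H : Subgroup B.G) n) :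
    ∃ g : B.G, altOn (B.interval n) ≤ trace (H.conj g : ClosedSubgroup B.G).toSubgroup n := by
  have := hW.to_subtype
  let T : Finset ℤ := Finset.Ico (-n : ℤ) (B.k n)
  have hT : (T : Set ℤ) = B.interval n := Finset.coe_Ico _ _
  let f : T ↪ W := (Finite.equivFin T).toEmbedding.trans
    (Fin.valEmbedding.trans (Infinite.natEmbedding _))
  obtain ⟨b, hb, hbf⟩ := exists_mem_altOn_extend (T := T) (hW.mono hWL)
    (hT ▸ interval_subset_Iio n) (Subtype.val_injective.comp f.injective)
    fun t => hWL (f t).2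
  have hbW : ∀ x ∈ B.interval n, b x ∈ W := fun x hx => by
    rw [← hT] at hx
    rw [hbf ⟨x, hx⟩]
    exact (f _).2
  refine ⟨⟨b, altOn_le_G _ hb⟩⁻¹, altOn_le_iff.2 fun x hx y hy z hz hxy hyz hxz =>
    ⟨altOn_mono (interval_subset_Iio n) (swap_mul_swap_mem_altOn hx hy hz hxy hyz hxz), ?_⟩⟩
  obtain ⟨-, d, hd, hmem⟩ := h (swap_mul_swap_mem_altOn (hbW x hx) (hbW y hy) (hbW z hz)
    (b.injective.ne hxy) (b.injective.ne hyz) (b.injective.ne hxz))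
  refine ⟨d, hd, mem_map_conj_iff.2 ?_⟩
  rw [← conj_swap_mul_swap, mul_assoc, ← (commute_prodHom (inv_mem hb) hd).eq.symm] at hmem
  simpa [mul_assoc] using hmem

/-- If all conjugates of `H` meet a compact set that does not contain `1`, then, for large `n`, some
conjugate of `H` contains the even permutations of `{-n, …, k n - 1}` modulo `∏_{j ≥ n} D j`. -/
theorem exists_altOn_le_trace_conj {H : ClosedSubgroup B.G} {C : Set B.G} (hC : IsCompact C)
    (h1 : (1 : B.G) ∉ C) (hH : ∀ g : B.G, ((H.conj g : Set B.G) ∩ C).Nonempty) :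
    ∃ N, ∀ n ≥ N, ∃ g : B.G,
      altOn (B.interval n) ≤ trace (H.conj g : ClosedSubgroup B.G).toSubgroup n := by
  obtain ⟨N, hN⟩ := exists_subset_level hC
  obtain ⟨M, hM⟩ := exists_tail_subset (hC.isClosed.isOpen_compl.mem_nhds h1)
  refine ⟨max N M, fun n hn => ?_⟩
  obtain ⟨W, hWL, hW, hWK⟩ := exists_infinite_altOn_le (L := Set.Iio (B.k n : ℤ))
    (T := Finset.Ico (-n : ℤ) (B.k n)) (F := altOn (B.interval n) \ {1})
    (K := trace (H : Subgroup B.G) n) (Set.Iio_infinite _) (by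
      rw [Finset.coe_Ico]
      exact interval_subset_Iio n)
    ((finite_altOn (Set.finite_Ico _ _)).subset Set.sdiff_subset) (fun h => h.2 rfl)
    (fun g hg x hx => altOn_apply_of_notMem hg.1 (by rwa [Finset.mem_Ico, ← Set.mem_Ico] at hx))
    (fun a ha => by
      obtain ⟨c, hcH, hcC⟩ := hH ⟨a, altOn_le_G _ ha⟩⁻¹
      obtain ⟨g, hg, d, hd, hc⟩ := hN n ((le_max_left N M).trans hn) c hcC
      refine ⟨g, ⟨hg, ?_⟩, mul_mem (mul_mem ha (altOn_mono (interval_subset_Iio n) hg))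
        (inv_mem ha), d, hd, ?_⟩
      -- With trivial finitary part, `c` would be a tail element, but for large `n` the tail lies in
      -- the complement of `C`.
      · rintro rfl
        refine hM n ((le_max_right N M).trans hn) d hd ?_
        convert hcC using 1
        exact Subtype.ext (by simpa using hc)
      · have := mem_map_conj_iff.1 ⟨c, hcH, rfl⟩
        rw [Subgroup.coe_subtype, ← hc] at this
        rw [mul_assoc _ a⁻¹, (commute_prodHom (inv_mem ha) hd).eq]
        simpa [mul_assoc] using this)
  exact exists_conj_altOn_le_trace hW hWL hWK

end BlockData

/-! ### Chabauty neighbourhoods and a criterion for URS's -/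

section Chabauty

variable {G : Type*} [Group G] [TopologicalSpace G]

/-- At the trivial subgroup, a condition of meeting `V` forces `1 ∈ V` and so holds for every
subgroup. Only the conditions of missing a compact set remain, and finitely many combine into one by
taking unions. -/
theorem ClosedSubgroup.exists_compact_of_isOpen {U : Set (ClosedSubgroup G)} (hU : IsOpen U)
    {H₀ : ClosedSubgroup G} (h : H₀ ∈ U) (h₀ : (H₀ : Subgroup G) = ⊥) :
    ∃ C : Set G, IsCompact C ∧ 1 ∉ C ∧ ∀ H : ClosedSubgroup G, (H : Set G) ∩ C = ∅ → H ∈ U := by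
  have hmem : ∀ x, x ∈ (H₀ : Set G) ↔ x = 1 := fun x => by
    change x ∈ (H₀ : Subgroup G) ↔ _
    rw [h₀, Subgroup.mem_bot]
  induction hU with
  | basic s hs =>
    rcases hs with ⟨V, -, -, rfl⟩ | ⟨C, hC, rfl⟩
    · obtain ⟨x, hx, hxV⟩ := h
      rw [hmem] at hx
      subst hx
      exact ⟨∅, isCompact_empty, Set.notMem_empty _, fun H _ => ⟨1, one_mem H, hxV⟩⟩
    · refine ⟨C, hC, fun h1 => ?_, fun H hH => hH⟩
      exact Set.notMem_empty 1 (h ▸ ⟨(hmem 1).2 rfl, h1⟩ : (1 : G) ∈ (∅ : Set G))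
  | univ => exact ⟨∅, isCompact_empty, Set.notMem_empty _, fun _ _ => Set.mem_univ _⟩
  | inter s t _ _ hs ht =>
    obtain ⟨C, hC, h1, hCs⟩ := hs h.1
    obtain ⟨C', hC', h1', hCt⟩ := ht h.2
    refine ⟨C ∪ C', hC.union hC', by simp [h1, h1'], fun H hH => ?_⟩
    rw [Set.inter_union_distrib_left, Set.union_empty_iff] at hH
    exact ⟨hCs H hH.1, hCt H hH.2⟩
  | sUnion S _ ih =>
    obtain ⟨s, hs, h⟩ := h
    obtain ⟨C, hC, h1, hCs⟩ := ih s hs h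
    exact ⟨C, hC, h1, fun H hH => ⟨s, hs, hCs H hH⟩⟩

theorem isClosed_setOf_eq_bot [T2Space G] [LocallyCompactSpace G] :
    IsClosed {H : ClosedSubgroup G | (H : Subgroup G) = ⊥} := by
  rw [← isOpen_compl_iff, isOpen_iff_forall_mem_open]
  intro H hH
  obtain ⟨x, hxH, hx⟩ : ∃ x ∈ (H : Subgroup G), x ≠ 1 := by
    by_contra! h
    exact hH ((Subgroup.eq_bot_iff_forall _).2 h)
  obtain ⟨V, hV, hxV, hVc⟩ := exists_isOpen_superset_and_isCompact_closure
    (isCompact_singleton (x := x))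
  refine ⟨{H : ClosedSubgroup G | ((H : Set G) ∩ (V ∩ {1}ᶜ)).Nonempty}, ?_, ?_,
    ⟨x, hxH, hxV rfl, hx⟩⟩
  · rintro K ⟨y, hyK, -, hy⟩ hK
    have hyK : y ∈ (K : Subgroup G) := hyK
    have hK : (K : Subgroup G) = ⊥ := hK
    rw [hK, Subgroup.mem_bot] at hyK
    exact hy hyK
  · exact TopologicalSpace.isOpen_generateFrom_of_mem (Or.inl ⟨_, hV.inter isOpen_compl_singleton,
      hVc.of_isClosed_subset isClosed_closure (closure_mono Set.inter_subset_left), rfl⟩)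

theorem isClosed_setOf_eq_top : IsClosed {H : ClosedSubgroup G | (H : Subgroup G) = ⊤} := by
  rw [← isOpen_compl_iff, isOpen_iff_forall_mem_open]
  intro H hH
  obtain ⟨x, hxH⟩ : ∃ x, x ∉ (H : Subgroup G) := by
    by_contra! h
    exact hH ((Subgroup.eq_top_iff' _).2 h)
  refine ⟨{H : ClosedSubgroup G | (H : Set G) ∩ {x} = ∅}, ?_, ?_, ?_⟩
  · intro K hK hK'
    have hK' : (K : Subgroup G) = ⊤ := hK'
    have hx : x ∈ (K : Subgroup G) := hK' ▸ Subgroup.mem_top x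
    exact Set.notMem_empty x (hK ▸ ⟨hx, rfl⟩ : x ∈ (∅ : Set G))
  · exact TopologicalSpace.isOpen_generateFrom_of_mem (Or.inr ⟨_, isCompact_singleton, rfl⟩)
  · exact Set.inter_singleton_eq_empty.2 hxH

/-- If every non-empty closed invariant set of closed subgroups contains the trivial subgroup or the
whole group, then the URS's of `G` are exactly the singletons of these two subgroups. -/
theorem hasNoNontrivialURS_of_forall [IsTopologicalGroup G] [T2Space G] [LocallyCompactSpace G]
    (h : ∀ X : Set (ClosedSubgroup G), X.Nonempty → IsClosed X →
      (∀ g : G, ∀ H ∈ X, H.conj g ∈ X) →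
      ∃ H ∈ X, (H : Subgroup G) = ⊥ ∨ (H : Subgroup G) = ⊤) :
    HasNoNontrivialURS G := by
  let P : Set (ClosedSubgroup G) → Prop := fun Y =>
    Y.Nonempty ∧ IsClosed Y ∧ ∀ g : G, ∀ H ∈ Y, H.conj g ∈ Y
  have hsub : ∀ {A : Subgroup G} {X : Set (ClosedSubgroup G)} {H : ClosedSubgroup G},
      H ∈ X → (H : Subgroup G) = A → {H : ClosedSubgroup G | (H : Subgroup G) = A} ⊆ X := by
    rintro A X H hH hA K hK
    have : K = H := ClosedSubgroup.toSubgroup_injective (Eq.trans hK hA.symm)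
    rwa [this]
  have hbot : P {H : ClosedSubgroup G | (H : Subgroup G) = ⊥} := by
    refine ⟨⟨⟨⊥, by exact isClosed_singleton (x := (1 : G))⟩, rfl⟩, isClosed_setOf_eq_bot,
      fun g H hH => ?_⟩
    change (H : Subgroup G).map _ = ⊥
    rw [show (H : Subgroup G) = ⊥ from hH, Subgroup.map_bot]
  have htop : P {H : ClosedSubgroup G | (H : Subgroup G) = ⊤} := by
    refine ⟨⟨⟨⊤, by exact isClosed_univ (X := G)⟩, rfl⟩, isClosed_setOf_eq_top, fun g H hH => ?_⟩
    change (H : Subgroup G).map _ = ⊤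
    rw [show (H : Subgroup G) = ⊤ from hH]
    exact Subgroup.map_top_of_surjective _ (MulAut.conj g).surjective
  intro X
  constructor
  · intro hX
    obtain ⟨H, hH, hA | hA⟩ := h X hX.prop.1 hX.prop.2.1 hX.prop.2.2
    · exact Or.inl (hX.eq_of_subset hbot (hsub hH hA)).symm
    · exact Or.inr (hX.eq_of_subset htop (hsub hH hA)).symm
  · have key : ∀ A : Subgroup G, P {H : ClosedSubgroup G | (H : Subgroup G) = A} →
        IsURS {H : ClosedSubgroup G | (H : Subgroup G) = A} := by
      refine fun A hA => ⟨hA, fun Y hY hYA => ?_⟩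
      obtain ⟨H, hH⟩ := hY.1
      exact hsub hH (hYA hH)
    rintro (rfl | rfl)
    exacts [key _ hbot, key _ htop]

end Chabauty

/-! ### The two assertions for the group -/

namespace BlockData

open Equiv.Perm

variable {B : BlockData}

/-- At the whole group the roles are reversed: missing `C` forces `C = ∅`, so only the conditions of
meeting an open set matter, and large traces ensure them. -/
theorem exists_altOn_le_trace_of_isOpen {U : Set (ClosedSubgroup B.G)} (hU : IsOpen U)
    {H₀ : ClosedSubgroup B.G} (h : H₀ ∈ U) (h₀ : (H₀ : Subgroup B.G) = ⊤) :
    ∃ N, ∀ n ≥ N, ∀ H : ClosedSubgroup B.G,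
      altOn (B.interval n) ≤ trace (H : Subgroup B.G) n → H ∈ U := by
  have hmem : ∀ x, x ∈ (H₀ : Set B.G) := fun x => by
    change x ∈ (H₀ : Subgroup B.G)
    rw [h₀]
    exact Subgroup.mem_top x
  induction hU with
  | basic s hs =>
    rcases hs with ⟨V, hV, -, rfl⟩ | ⟨C, hC, rfl⟩
    · obtain ⟨N, hN⟩ := exists_inter_nonempty hV (h.mono Set.inter_subset_right)
      exact ⟨N, fun n hn H hH => hN n hn H hH⟩
    · refine ⟨0, fun n _ H _ => ?_⟩
      have hC : C = ∅ := Set.eq_empty_of_forall_notMem fun x hx =>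
        Set.notMem_empty x (h ▸ ⟨hmem x, hx⟩ : x ∈ (∅ : Set B.G))
      change _ ∩ C = ∅
      rw [hC, Set.inter_empty]
  | univ => exact ⟨0, fun _ _ _ _ => Set.mem_univ _⟩
  | inter s t _ _ hs ht =>
    obtain ⟨N, hN⟩ := hs h.1
    obtain ⟨M, hM⟩ := ht h.2
    exact ⟨max N M, fun n hn H hH => ⟨hN n ((le_max_left N M).trans hn) H hH,
      hM n ((le_max_right N M).trans hn) H hH⟩⟩
  | sUnion S _ ih =>
    obtain ⟨s, hs, h⟩ := h
    obtain ⟨N, hN⟩ := ih s hs h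
    exact ⟨N, fun n hn H hH => ⟨s, hs, hN n hn H hH⟩⟩

theorem exists_mem_eq_bot_or_eq_top {X : Set (ClosedSubgroup B.G)} (hne : X.Nonempty)
    (hX : IsClosed X) (hconj : ∀ g : B.G, ∀ H ∈ X, H.conj g ∈ X) :
    ∃ H ∈ X, (H : Subgroup B.G) = ⊥ ∨ (H : Subgroup B.G) = ⊤ := by
  by_contra! h
  obtain ⟨H, hH⟩ := hne
  have hbot : (⟨⊥, by exact isClosed_singleton (x := (1 : B.G))⟩ : ClosedSubgroup B.G) ∈ Xᶜ :=
    fun hmem => (h _ hmem).1 rfl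
  have htop : (⟨⊤, by exact isClosed_univ (X := B.G)⟩ : ClosedSubgroup B.G) ∈ Xᶜ :=
    fun hmem => (h _ hmem).2 rfl
  obtain ⟨C, hC, h1, hCX⟩ := ClosedSubgroup.exists_compact_of_isOpen hX.isOpen_compl hbot rfl
  obtain ⟨N, hN⟩ := exists_altOn_le_trace_of_isOpen hX.isOpen_compl htop rfl
  obtain ⟨M, hM⟩ := exists_altOn_le_trace_conj (H := H) hC h1 fun g => by
    rw [Set.nonempty_iff_ne_empty]
    exact fun h => hCX _ h (hconj g H hH)
  obtain ⟨g, hg⟩ := hM (max N M) (le_max_right N M)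
  exact hN _ (le_max_left N M) _ hg (hconj g H hH)

theorem eq_top_of_forall_altOn_le_trace {H : ClosedSubgroup B.G}
    (h : ∀ n, altOn (Set.Iio (B.k n : ℤ)) ≤ trace (H : Subgroup B.G) n) :
    (H : Subgroup B.G) = ⊤ := by
  by_contra hne
  obtain ⟨x, hx⟩ : ∃ x, x ∉ (H : Subgroup B.G) := by
    by_contra! h
    exact hne ((Subgroup.eq_top_iff' _).2 h)
  obtain ⟨N, hN⟩ := exists_inter_nonempty (V := ((H : Subgroup B.G) : Set B.G)ᶜ)
    H.isClosed'.isOpen_compl ⟨x, hx⟩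
  obtain ⟨y, hy, hy'⟩ := hN N le_rfl _ ((altOn_mono (interval_subset_Iio N)).trans (h N))
  exact hy' hy

open MeasureTheory in
theorem altOn_le_trace_of_hasFiniteCovolume {H : ClosedSubgroup B.G} (hH : HasFiniteCovolume H)
    (n : ℕ) : altOn (Set.Iio (B.k n : ℤ)) ≤ trace (H : Subgroup B.G) n := by
  obtain ⟨_, _, μ, hμ, hinv⟩ := hH
  let U : Set (B.G ⧸ (H : Subgroup B.G)) :=
    QuotientGroup.mk '' ((B.tail n).map B.prodToG : Set B.G)
  have hU : IsOpen U := QuotientGroup.isOpenMap_coe _ (isOpen_map_tail n)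
  have htrans : ∀ g : B.G, IsOpen ((fun y => g⁻¹ • y) ⁻¹' U) := fun g =>
    hU.preimage (continuous_const_smul g⁻¹)
  have hmeas : ∀ g : B.G, μ ((fun y => g⁻¹ • y) ⁻¹' U) = μ U := fun g =>
    measure_preimage_smul_of_nullMeasurableSet hU.measurableSet.nullMeasurableSet g⁻¹
  -- Every element of `G` is a finitary even permutation times an element of `B.tail n`, so the
  -- translates of `U` by the countable group `finitaryAlternatingGroup ℤ` cover the coset space and
  -- cannot all be null.
  have hpos : μ U ≠ 0 := by
    intro h0
    have : Countable (finitaryAlternatingGroup ℤ) :=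
      countable_finitaryAlternatingGroup.to_subtype
    have hG : ∀ a : finitaryAlternatingGroup ℤ, (a : Equiv.Perm ℤ) ∈ B.G := fun a =>
      Subgroup.subset_closure (Or.inl a.2)
    have hcover : (Set.univ : Set (B.G ⧸ (H : Subgroup B.G))) ⊆
        ⋃ a : finitaryAlternatingGroup ℤ, (fun y => (⟨a, hG a⟩ : B.G)⁻¹ • y) ⁻¹' U := by
      rintro y -
      obtain ⟨g, rfl⟩ := QuotientGroup.mk_surjective y
      obtain ⟨m, hm⟩ := exists_mem_level g.2
      obtain ⟨a, ha, d, hd, hg⟩ := level_mono (le_max_left m n) hm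
      refine Set.mem_iUnion.2 ⟨⟨a, altOn_le_finitaryAlternatingGroup _ ha⟩, B.prodToG d,
        ⟨d, tail_anti (le_max_right m n) hd, rfl⟩, ?_⟩
      beta_reduce
      refine congrArg (QuotientGroup.mk (s := (H : Subgroup B.G))) ?_
      apply Subtype.ext
      simp [← hg]
    have := measure_mono_null hcover (measure_iUnion_null fun a => (hmeas _).trans h0)
    simp at this
  refine altOn_le_of_forall_exists_inv_mul_mem (Set.Iio_infinite _) fun x hx => ?_
  let x' : ℕ → B.G := fun i => ⟨x i, altOn_le_G _ (hx i)⟩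
  -- Infinitely many translates of the same positive measure in a probability space: two of them
  -- meet. A common point puts `(x i * d)⁻¹ * (x j * e)` in `H`; commuting `d⁻¹` past `(x i)⁻¹ * x
  -- j` gives an element of the trace.
  obtain ⟨i, j, hij, y, ⟨_, ⟨d, hd, rfl⟩, hi⟩, ⟨_, ⟨e, he, rfl⟩, hj⟩⟩ :=
    exists_nonempty_inter_of_measure_univ_lt_tsum_measure μ
      (s := fun i => (fun y => (x' i)⁻¹ • y) ⁻¹' U)
      (fun i => (htrans (x' i)).measurableSet.nullMeasurableSet) (by
        simp only [hmeas]
        rw [ENNReal.tsum_const_eq_top_of_ne_zero hpos, measure_univ]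
        exact ENNReal.one_lt_top)
  have hxx : (x i)⁻¹ * x j ∈ altOn (Set.Iio (B.k n : ℤ)) := mul_mem (inv_mem (hx i)) (hx j)
  refine ⟨i, j, hij, hxx, d⁻¹ * e, mul_mem (inv_mem hd) he, ?_⟩
  have hq : (QuotientGroup.mk (x' i * B.prodToG d) : B.G ⧸ (H : Subgroup B.G)) =
      QuotientGroup.mk (x' j * B.prodToG e) := by
    have h1 : ∀ k : ℕ, ∀ p : B.G, QuotientGroup.mk p = (x' k)⁻¹ • y →
        (QuotientGroup.mk (x' k * p) : B.G ⧸ (H : Subgroup B.G)) = y := fun k p h => by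
      rw [← smul_eq_mul, ← MulAction.Quotient.smul_mk, h, smul_inv_smul]
    rw [h1 i _ hi, h1 j _ hj]
  refine ⟨_, QuotientGroup.eq.1 hq, ?_⟩
  have hc := (commute_prodHom hxx (inv_mem hd)).eq
  rw [map_mul B.prodHom, ← mul_assoc ((x i)⁻¹ * x j), hc]
  simp [x', mul_assoc]

end BlockData

theorem mainTheorem6 (B : BlockData) :
    HasNoNontrivialURS B.G ∧
      ∀ H : ClosedSubgroup B.G, HasFiniteCovolume H → (H : Subgroup B.G) = ⊤ :=
  ⟨hasNoNontrivialURS_of_forall fun _ => BlockData.exists_mem_eq_bot_or_eq_top, fun _ hH =>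
    BlockData.eq_top_of_forall_altOn_le_trace (BlockData.altOn_le_trace_of_hasFiniteCovolume hH)⟩
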